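/- Let $G$ be a finite group and $Q\subseteq G$ a generating set. For a unitary representation $(R,V)$ of $G$ on a complex Hilbert space (of arbitrary dimension) without nonzero invariant vectors put $$\kappa_G(Q,R)=\inf_{v\in V,\ \|v\|=1}\ \max_{q\in Q}\|R(q)v-v\|\in[0,\infty]$$ (with $\inf\emptyset=\infty$), and let $\kappa_G(Q)=\inf_R\kappa_G(Q,R)$, where $R$ ranges over all such representations. Let $n\ge 4$, let $T_n$ be the set of all transpositions of the symmetric group $S_n$, and let $D'$ be a unitary representation of $S_n$ isomorphic to the irreducible representation $[n-1,1]$, that is, to the restriction of the permutation representation of $S_n$ on $\mathbb C^n$ to the subspace $\{u\in\mathbb C^n:\sum_k u_k=0\}$. Then $$\frac{2}{\sqrt{n-1}}=\kappa_{S_n}(T_n)<\kappa_{S_n}(T_n,D').$$ In particular, the analogue of Aldous' spectral gap conjecture for the Kazhdan constant fails: it is not true that $\kappa_{S_n}(Q)=\kappa_{S_n}(Q,D')$ for every set $Q\subseteq T_n$ of transpositions that generates $S_n$. -/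

import Mathlib

open scoped ENNReal

universe u v w

namespace Kazhdan

/-- A representation on a complex inner product space is unitary if every group element acts
isometrically (each `ρ g` is invertible, so it is then a unitary operator). -/
def IsUnitary {G : Type w} [Group G] {V : Type u} [NormedAddCommGroup V] [InnerProductSpace ℂ V]
    (ρ : Representation ℂ G V) : Prop :=
  ∀ (g : G) (x : V), ‖ρ g x‖ = ‖x‖

/-- The Kazhdan constant `κ_G(Q, ρ) = inf_{‖x‖ = 1} sup_{q ∈ Q} ‖ρ(q) x - x‖`.
It takes values in `[0, ∞]`, so that the infimum over the (empty) unit sphere of the zero space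
is `∞` and does not influence the minimum over all representations. -/
noncomputable def kazhdanConstantRep {G : Type w} [Group G] {V : Type u} [NormedAddCommGroup V]
    [InnerProductSpace ℂ V] (Q : Set G) (ρ : Representation ℂ G V) : ℝ≥0∞ :=
  ⨅ (x : V) (_ : ‖x‖ = 1), ⨆ q ∈ Q, ENNReal.ofReal ‖ρ q x - x‖

/-- The Kazhdan constant `κ_G(Q)`: the infimum of `κ_G(Q, ρ)` over all unitary representations
`ρ` of `G`, on complex Hilbert spaces of arbitrary dimension, without nonzero invariant vectors. -/
noncomputable def kazhdanConstant {G : Type w} [Group G] (Q : Set G) : ℝ≥0∞ :=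
  ⨅ (V : Type u) (_ : NormedAddCommGroup V) (_ : InnerProductSpace ℂ V) (_ : CompleteSpace V)
    (ρ : Representation ℂ G V) (_ : IsUnitary ρ) (_ : ρ.invariants = ⊥), kazhdanConstantRep Q ρ

/-- The set of all transpositions of `S_n`. -/
def transpositions (n : ℕ) : Set (Equiv.Perm (Fin n)) :=
  {g | g.IsSwap}

/-- The `n`-dimensional permutation representation of `S_n` on `ℂⁿ` with its Euclidean norm,
`D(π) e_k = e_{π k}`. -/
noncomputable def permRep (n : ℕ) :
    Representation ℂ (Equiv.Perm (Fin n)) (EuclideanSpace ℂ (Fin n)) where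
  toFun π := (LinearIsometryEquiv.piLpCongrLeft 2 ℂ ℂ π).toLinearEquiv.toLinearMap
  map_one' := by
    ext x i
    rfl
  map_mul' π τ := by
    ext x i
    rfl

theorem permRep_apply (n : ℕ) (π : Equiv.Perm (Fin n)) (x : EuclideanSpace ℂ (Fin n))
    (k : Fin n) : permRep n π x k = x (π⁻¹ k) := rfl

theorem permRep_single (n : ℕ) (π : Equiv.Perm (Fin n)) (k : Fin n) :
    permRep n π (EuclideanSpace.single k 1) = EuclideanSpace.single (π k) 1 :=
  EuclideanSpace.piLpCongrLeft_single π k 1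

theorem permRep_isUnitary (n : ℕ) : IsUnitary (permRep n) := fun π x =>
  (LinearIsometryEquiv.piLpCongrLeft 2 ℂ ℂ π).norm_map x

/-- The subrepresentation of the permutation representation on the orthogonal complement of
`e_1 + ⋯ + e_n`. -/
noncomputable def standardSubrep (n : ℕ) : Subrepresentation (permRep n) where
  toSubmodule := (ℂ ∙ (∑ k, EuclideanSpace.single k 1 : EuclideanSpace ℂ (Fin n)))ᗮ
  apply_mem_toSubmodule π x hx := by
    rw [Submodule.mem_orthogonal_singleton_iff_inner_right] at hx ⊢
    simp only [sum_inner, EuclideanSpace.inner_single_left, map_one, one_mul, permRep_apply]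
      at hx ⊢
    rw [← hx]
    exact Equiv.sum_comp π⁻¹ (fun k => x k)

/-- The irreducible representation `[n-1,1]` of `S_n`, realized as the complement of the trivial
representation in the permutation representation. -/
noncomputable def standardRep (n : ℕ) :
    Representation ℂ (Equiv.Perm (Fin n)) (standardSubrep n).toSubmodule :=
  (standardSubrep n).toRepresentation

theorem standardRep_isUnitary (n : ℕ) :
    IsUnitary (V := (standardSubrep n).toSubmodule) (standardRep n) := fun π x =>
  permRep_isUnitary n π x

end Kazhdan

namespace Kazhdan

open Equiv Finset

/-! The lower bound is an averaging argument. The complete-graph Laplacian, summed over ordered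
pairs, is at least `2 * n` on the complement of the invariants (`IsUnitary.laplacian_gap`). So the
`n (n - 1)` squared displacements of a unit vector sum to at least `4 n`, and some transposition
moves it by at least `2 / √(n - 1)`. Equality forces all displacements to agree
(`IsUnitary.norm_swap_sub_sq_eq`).

The bound is attained in `n` copies of `[n-1,1]`, where a vector encodes a configuration of `n`
points in `ℂⁿ`: take the regular simplex. A single copy only encodes `n` points of the plane `ℂ`,
and the displacement under `(i j)` is proportional to the distance between points `i` and `j`. Four
points of a plane are not equidistant unless they coincide, so equality fails for every unit vector,
and compactness of the sphere makes the inequality strict. -/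

theorem rep_refl_apply {α V : Type*} [AddCommGroup V] [Module ℂ V]
    (ρ : Representation ℂ (Perm α) V) (x : V) : ρ (Equiv.refl α) x = x := by
  rw [← Perm.one_def, map_one, Module.End.one_apply]

/-! ### Spectral gap of the complete-graph Laplacian -/

section Laplacian

variable {α : Type*} [DecidableEq α] {V : Type*} [NormedAddCommGroup V] [InnerProductSpace ℂ V]

theorem IsUnitary.continuous {G : Type*} [Group G] {ρ : Representation ℂ G V} (h : IsUnitary ρ)
    (g : G) : Continuous (ρ g) :=
  (AddMonoidHomClass.isometry_of_norm (ρ g) (h g)).continuous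

theorem IsUnitary.inner_map_map {G : Type*} [Group G] {ρ : Representation ℂ G V}
    (h : IsUnitary ρ) (g : G) (x y : V) : inner ℂ (ρ g x) (ρ g y) = inner ℂ x y :=
  LinearIsometry.inner_map_map ⟨ρ g, h g⟩ x y

theorem swap_swap_apply (ρ : Representation ℂ (Perm α) V) (i j : α) (x : V) :
    ρ (swap i j) (ρ (swap i j) x) = x := by
  rw [← Module.End.mul_apply, ← map_mul, swap_mul_self, map_one, Module.End.one_apply]

theorem IsUnitary.inner_swap_left {ρ : Representation ℂ (Perm α) V} (h : IsUnitary ρ) (i j : α)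
    (x y : V) : inner ℂ (ρ (swap i j) x) y = inner ℂ x (ρ (swap i j) y) := by
  rw [← h.inner_map_map (swap i j), swap_swap_apply]

/-- The vectors fixed by all transpositions of elements of `S`. -/
def swapInvariants (ρ : Representation ℂ (Perm α) V) (S : Finset α) : Submodule ℂ V where
  carrier := {x | ∀ i ∈ S, ∀ j ∈ S, ρ (swap i j) x = x}
  add_mem' hx hy i hi j hj := by rw [map_add, hx i hi j hj, hy i hi j hj]
  zero_mem' i _ j _ := map_zero _
  smul_mem' c x hx i hi j hj := by rw [map_smul, hx i hi j hj]

/-- The Laplacian of the complete graph on `S`, summed over ordered pairs. -/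
noncomputable def laplacian (ρ : Representation ℂ (Perm α) V) (S : Finset α) : V →ₗ[ℂ] V :=
  ∑ i ∈ S, ∑ j ∈ S, (LinearMap.id - ρ (swap i j))

theorem laplacian_apply (ρ : Representation ℂ (Perm α) V) (S : Finset α) (x : V) :
    laplacian ρ S x = ∑ i ∈ S, ∑ j ∈ S, (x - ρ (swap i j) x) := by
  simp [laplacian, LinearMap.sum_apply]

theorem IsUnitary.continuous_laplacian {ρ : Representation ℂ (Perm α) V} (h : IsUnitary ρ)
    (S : Finset α) : Continuous (laplacian ρ S) := by
  have : (laplacian ρ S : V → V) = fun x => ∑ i ∈ S, ∑ j ∈ S, (x - ρ (swap i j) x) :=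
    funext (laplacian_apply ρ S)
  rw [this]
  exact continuous_finsetSum _ fun i _ => continuous_finsetSum _ fun j _ =>
    continuous_id.sub (h.continuous _)

theorem IsUnitary.inner_laplacian_left {ρ : Representation ℂ (Perm α) V} (h : IsUnitary ρ)
    (S : Finset α) (x y : V) :
    inner ℂ (laplacian ρ S x) y = inner ℂ x (laplacian ρ S y) := by
  simp only [laplacian_apply, sum_inner, inner_sum, inner_sub_left, inner_sub_right,
    h.inner_swap_left]

theorem IsUnitary.norm_swap_sub_sq {ρ : Representation ℂ (Perm α) V} (h : IsUnitary ρ)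
    (i j : α) (x : V) :
    ‖ρ (swap i j) x - x‖ ^ 2 = 2 * (inner ℂ (x - ρ (swap i j) x) x).re := by
  have h1 := norm_sub_sq (𝕜 := ℂ) (ρ (swap i j) x) x
  have h2 : (inner ℂ x x : ℂ).re = ‖x‖ ^ 2 := inner_self_eq_norm_sq (𝕜 := ℂ) x
  rw [h1, h, inner_sub_left, Complex.sub_re, h2]
  simp only [RCLike.re_to_complex]
  ring

theorem IsUnitary.sum_norm_sq_eq {ρ : Representation ℂ (Perm α) V} (h : IsUnitary ρ)
    (S : Finset α) (x : V) :
    ∑ i ∈ S, ∑ j ∈ S, ‖ρ (swap i j) x - x‖ ^ 2 = 2 * (inner ℂ (laplacian ρ S x) x).re := by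
  simp only [laplacian_apply, sum_inner, Complex.re_sum, h.norm_swap_sub_sq, mul_sum]

/-- The `(l k)` represent the cosets of `Sym(S \ {k})` in `Sym(S)`, so a transposition `(i j)`
merely permutes the summands, by `l ↦ (i j) l`. -/
theorem sum_swap_mem_swapInvariants {ρ : Representation ℂ (Perm α) V} {S : Finset α} {k : α}
    (hk : k ∈ S) {x : V} (hx : x ∈ swapInvariants ρ (S.erase k)) :
    ∑ l ∈ S, ρ (swap l k) x ∈ swapInvariants ρ S := by
  intro i hi j hj
  rw [map_sum]
  have key : ∀ l ∈ S, ρ (swap i j) (ρ (swap l k) x) = ρ (swap (swap i j l) k) x := by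
    intro l hl
    have hx' : ∀ a ∈ S, ∀ b ∈ S, a ≠ k → b ≠ k → ρ (swap a b) x = x := fun a ha b hb hak hbk =>
      hx a (mem_erase.2 ⟨hak, ha⟩) b (mem_erase.2 ⟨hbk, hb⟩)
    have move : ∀ (a b c d : α), ρ (swap a b) (ρ (swap c d) x)
        = ρ (swap (swap a b c) (swap a b d)) (ρ (swap a b) x) := by
      intro a b c d
      simp only [← Module.End.mul_apply, ← map_mul]
      rw [swap_apply_apply]
      simp [mul_assoc]
    have movek : ∀ a ∈ S, ρ (swap k a) (ρ (swap l k) x) = ρ (swap (swap k a l) k) x := by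
      intro a ha
      by_cases hak : a = k
      · subst hak; simp [rep_refl_apply]
      by_cases hlk : l = k
      · subst hlk; simp [swap_comm, rep_refl_apply]
      by_cases hla : l = a
      · subst hla; rw [swap_comm k l, swap_swap_apply]; simp [rep_refl_apply]
      -- Here `(k a)(l k) = (l k)(l a)`, and `(l a)` fixes `x`.
      · have := move l k l a
        rw [swap_apply_left, swap_apply_of_ne_of_ne (Ne.symm hla) hak,
          hx' l hl a ha hlk hak] at this
        rw [swap_apply_of_ne_of_ne hlk hla, ← this]
    by_cases hik : i = k
    · subst hik; exact movek j hj
    by_cases hjk : j = k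
    · subst hjk; rw [swap_comm i j]; exact movek i hi
    · rw [move, hx' i hi j hj hik hjk, swap_apply_of_ne_of_ne (Ne.symm hik) (Ne.symm hjk)]
  rw [sum_congr rfl key]
  refine sum_bij (fun l _ => swap i j l) (fun l hl => ?_) (fun a _ b _ hab => (swap i j).injective hab)
    (fun b hb => ⟨swap i j b, ?_, swap_apply_self i j b⟩) (fun _ _ => rfl)
  all_goals
    rw [swap_apply_def]; split_ifs <;> assumption

theorem laplacian_eq_erase {ρ : Representation ℂ (Perm α) V} {S : Finset α} {k : α}
    (hk : k ∈ S) (x : V) :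
    laplacian ρ S x = laplacian ρ (S.erase k) x + (2 : ℂ) • ∑ i ∈ S, (x - ρ (swap i k) x) := by
  have h0 : ∀ i, ∑ j ∈ S, (x - ρ (swap i j) x)
      = (x - ρ (swap i k) x) + ∑ j ∈ S.erase k, (x - ρ (swap i j) x) := fun i =>
    (add_sum_erase _ _ hk).symm
  have h1 : ∑ j ∈ S.erase k, (x - ρ (swap k j) x) = ∑ j ∈ S, (x - ρ (swap j k) x) := by
    rw [← add_sum_erase S _ hk]
    simp [swap_comm, rep_refl_apply]
  simp only [laplacian_apply]
  rw [sum_congr rfl fun i _ => h0 i, sum_add_distrib, ← add_sum_erase S (fun i =>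
    ∑ j ∈ S.erase k, (x - ρ (swap i j) x)) hk, h1, two_smul]
  abel

/-- A pair `i ≠ j` survives the deletion of `k` for exactly `#S - 2` choices of `k`; diagonal terms
vanish. -/
theorem sum_laplacian_erase (ρ : Representation ℂ (Perm α) V) (S : Finset α) (x : V) :
    ∑ k ∈ S, laplacian ρ (S.erase k) x = ((#S : ℂ) - 2) • laplacian ρ S x := by
  have h : ∀ k ∈ S, laplacian ρ (S.erase k) x
      = laplacian ρ S x - (2 : ℂ) • ∑ i ∈ S, (x - ρ (swap i k) x) := fun k hk => by
    rw [laplacian_eq_erase hk]; abel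
  rw [sum_congr rfl h, sum_sub_distrib, ← smul_sum, sum_comm, ← laplacian_apply, sum_const,
    sub_smul, Nat.cast_smul_eq_nsmul]

theorem laplacian_eq_zero {ρ : Representation ℂ (Perm α) V} {S : Finset α} {x : V}
    (hx : x ∈ swapInvariants ρ S) : laplacian ρ S x = 0 := by
  rw [laplacian_apply]
  exact sum_eq_zero fun i hi => sum_eq_zero fun j hj => by rw [hx i hi j hj, sub_self]

/-- Up to an `S`-invariant vector, a vector fixed by the transpositions of `S \ {k}` is an
eigenvector of the Laplacian with eigenvalue `2 |S|`. -/
theorem exists_sub_mem_eigenspace {ρ : Representation ℂ (Perm α) V} {S : Finset α} {k : α}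
    (hk : k ∈ S) {x : V} (hx : x ∈ swapInvariants ρ (S.erase k)) :
    ∃ a ∈ swapInvariants ρ S, laplacian ρ S (x - a) = (2 * #S : ℂ) • (x - a) := by
  have hS : (#S : ℂ) ≠ 0 := Nat.cast_ne_zero.2 (card_ne_zero_of_mem hk)
  have ha := (swapInvariants ρ S).smul_mem (#S : ℂ)⁻¹ (sum_swap_mem_swapInvariants hk hx)
  -- The invariant vector `a` is the average of the `ρ (swap l k) x`, and `laplacian ρ S x = 2 ∑ (x
  -- - ρ (swap l k) x) = 2 #S (x - a)`.
  refine ⟨_, ha, ?_⟩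
  rw [map_sub, laplacian_eq_zero ha, sub_zero, laplacian_eq_erase hk, laplacian_eq_zero hx,
    zero_add, sum_sub_distrib, sum_const, mul_smul, smul_sub (#S : ℂ), smul_inv_smul₀ hS,
    Nat.cast_smul_eq_nsmul]

/-- Induction on `#S`. Split off the eigenspace `M` of the value `2 * #S`. The remainder `w` is
orthogonal to the invariants of every `S \ {k}`, since these lie in `M` plus the `S`-invariants. The
induction hypothesis for all `S \ {k}`, summed over `k`, then bounds `w`. -/
theorem IsUnitary.laplacian_gap [CompleteSpace V] {ρ : Representation ℂ (Perm α) V}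
    (h : IsUnitary ρ) (S : Finset α) (x : V) (hx : x ∈ (swapInvariants ρ S)ᗮ) :
    2 * #S * ‖x‖ ^ 2 ≤ (inner ℂ (laplacian ρ S x) x).re := by
  induction hc : #S generalizing S x with
  | zero =>
    obtain rfl := card_eq_zero.1 hc
    simp [laplacian_apply]
  | succ m ih =>
    let M : Submodule ℂ V := LinearMap.ker (laplacian ρ S - (2 * #S : ℂ) • LinearMap.id)
    have hM : ∀ y, y ∈ M ↔ laplacian ρ S y = (2 * #S : ℂ) • y := fun y => by
      simp [M, sub_eq_zero]
    -- `V` may be infinite-dimensional, so projecting onto `M` needs closedness.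
    have hMc : IsClosed (M : Set V) := by
      have : (M : Set V) = {y | laplacian ρ S y = (2 * #S : ℂ) • y} := Set.ext hM
      rw [this]
      exact isClosed_eq (h.continuous_laplacian S) (continuous_id.const_smul _)
    have : CompleteSpace M := hMc.completeSpace_coe
    obtain ⟨y, hy, w, hw, rfl⟩ := M.exists_add_mem_mem_orthogonal x
    -- `M ⊆ Inv(S)ᗮ`, since distinct eigenspaces are orthogonal
    have hy' : y ∈ (swapInvariants ρ S)ᗮ := by
      rw [Submodule.mem_orthogonal]
      intro a ha
      have h1 := h.inner_laplacian_left S a y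
      rw [laplacian_eq_zero ha, (hM y).1 hy, inner_zero_left, inner_smul_right] at h1
      have : (2 * #S : ℂ) ≠ 0 := by rw [hc]; norm_cast
      exact (mul_eq_zero.1 h1.symm).resolve_left this
    have hw' : w ∈ (swapInvariants ρ S)ᗮ := by
      simpa using Submodule.sub_mem _ hx hy'
    have hyw : inner ℂ y w = 0 := hw y hy
    have hwy : inner ℂ w y = 0 := inner_eq_zero_symm.1 hyw
    have hwk : ∀ k ∈ S, w ∈ (swapInvariants ρ (S.erase k))ᗮ := by
      intro k hk
      rw [Submodule.mem_orthogonal]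
      intro b hb
      obtain ⟨a, ha, hab⟩ := exists_sub_mem_eigenspace hk hb
      have h1 := hw _ ((hM _).2 hab)
      rw [inner_sub_left, hw' a ha, sub_zero] at h1
      exact h1
    have hsum : (m + 1) * (2 * m * ‖w‖ ^ 2)
        ≤ ((m : ℝ) - 1) * (inner ℂ (laplacian ρ S w) w).re := by
      have h1 : ∀ k ∈ S, 2 * m * ‖w‖ ^ 2 ≤ (inner ℂ (laplacian ρ (S.erase k) w) w).re :=
        fun k hk => ih _ w (hwk k hk) (by rw [card_erase_of_mem hk, hc]; rfl)
      have h2 := sum_le_sum h1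
      rw [sum_const, ← Complex.re_sum, ← sum_inner, sum_laplacian_erase, inner_smul_left, hc,
        nsmul_eq_mul] at h2
      have h3 : (starRingEnd ℂ) (((m + 1 : ℕ) : ℂ) - 2) = (((m : ℝ) - 1 : ℝ) : ℂ) := by
        simp only [map_sub, map_natCast, map_ofNat]
        push_cast; ring
      rw [h3, Complex.re_ofReal_mul] at h2
      exact_mod_cast h2
    have hwgap : 2 * (m + 1) * ‖w‖ ^ 2 ≤ (inner ℂ (laplacian ρ S w) w).re := by
      -- The factor `m - 1` in `hsum` is useless for `m ≤ 1`; but then `S \ {k}` has at most one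
      -- point, every vector is invariant under it, and `w = 0`.
      rcases Nat.lt_or_ge m 2 with hm | hm
      · have hw0 : w = 0 := by
          obtain ⟨k, hk⟩ : S.Nonempty := card_pos.1 (by omega)
          have : w ∈ swapInvariants ρ (S.erase k) := by
            intro i hi j hj
            have : #(S.erase k) ≤ 1 := by rw [card_erase_of_mem hk]; omega
            rw [card_le_one.1 this i hi j hj, swap_self, rep_refl_apply]
          exact inner_self_eq_zero.1 (hwk k hk w this)
        simp [hw0]
      · have hm' : (2 : ℝ) ≤ m := by exact_mod_cast hm
        have hpos : (0 : ℝ) < (m : ℝ) - 1 := by linarith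
        refine le_of_mul_le_mul_left (le_trans ?_ hsum) hpos
        have := sq_nonneg ‖w‖
        nlinarith [mul_nonneg (by positivity : (0 : ℝ) ≤ m + 1) this]
    have hΔy : laplacian ρ S y = (2 * #S : ℂ) • y := (hM y).1 hy
    have e1 : inner ℂ (laplacian ρ S (y + w)) (y + w)
        = (2 * #S : ℂ) * inner ℂ y y + inner ℂ (laplacian ρ S w) w := by
      rw [map_add, inner_add_left, inner_add_right, inner_add_right,
        h.inner_laplacian_left S w y, hΔy, inner_smul_left, inner_smul_left, inner_smul_right,
        hyw, hwy]
      simp [Complex.conj_ofNat]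
    have e2 : ‖y + w‖ ^ 2 = ‖y‖ ^ 2 + ‖w‖ ^ 2 := by
      have := norm_add_sq_eq_norm_sq_add_norm_sq_of_inner_eq_zero y w hyw
      nlinarith
    have e3 : ((2 * #S : ℂ) * inner ℂ y y).re = 2 * (m + 1) * ‖y‖ ^ 2 := by
      rw [inner_self_eq_norm_sq_to_K, hc]
      have : (2 * ((m + 1 : ℕ) : ℂ)) * ((‖y‖ : ℂ)) ^ 2 = ((2 * (m + 1) * ‖y‖ ^ 2 : ℝ) : ℂ) := by
        push_cast; ring
      exact (congrArg Complex.re this).trans (Complex.ofReal_re _)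
    rw [e1, e2, Complex.add_re, e3]
    push_cast
    linarith

end Laplacian

/-! ### The lower bound and its equality case -/

section LowerBound

variable {n : ℕ} {V : Type*} [NormedAddCommGroup V] [InnerProductSpace ℂ V]
  {ρ : Representation ℂ (Perm (Fin n)) V}

theorem swapInvariants_univ_le (ρ : Representation ℂ (Perm (Fin n)) V) :
    swapInvariants ρ univ ≤ ρ.invariants := by
  intro x hx
  rw [Representation.mem_invariants]
  intro g
  induction g using Perm.swap_induction_on with
  | one => rw [map_one, Module.End.one_apply]
  | swap_mul f i j _ ih =>
    rw [map_mul, Module.End.mul_apply, ih, hx i (mem_univ i) j (mem_univ j)]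

theorem IsUnitary.four_mul_le_sum [CompleteSpace V] (h : IsUnitary ρ) (hinv : ρ.invariants = ⊥)
    (x : V) : 4 * n * ‖x‖ ^ 2 ≤ ∑ i, ∑ j, ‖ρ (swap i j) x - x‖ ^ 2 := by
  have hx : x ∈ (swapInvariants ρ univ)ᗮ := by
    rw [eq_bot_iff.2 ((swapInvariants_univ_le ρ).trans hinv.le), Submodule.bot_orthogonal_eq_top]
    exact Submodule.mem_top
  have h1 := h.laplacian_gap univ x hx
  rw [card_univ, Fintype.card_fin] at h1
  rw [h.sum_norm_sq_eq]
  linarith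

/-- The average of `‖ρ(q) x - x‖²` over all transpositions `q` is at least `4 / (n - 1)`; hence if
no term exceeds this value then all terms are equal to it. -/
theorem IsUnitary.norm_swap_sub_sq_eq [CompleteSpace V] (h : IsUnitary ρ)
    (hinv : ρ.invariants = ⊥) (hn : 2 ≤ n) {x : V} (hx : ‖x‖ = 1)
    (hle : ∀ i j, i ≠ j → ‖ρ (swap i j) x - x‖ ^ 2 ≤ 4 / ((n : ℝ) - 1)) {i j : Fin n}
    (hij : i ≠ j) : ‖ρ (swap i j) x - x‖ ^ 2 = 4 / ((n : ℝ) - 1) := by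
  have hn' : (2 : ℝ) ≤ n := by exact_mod_cast hn
  set c : ℝ := 4 / ((n : ℝ) - 1) with hc
  -- The deficits are nonnegative, and their sum is at most `n (n - 1) c - 4 n = 0`.
  let d : Fin n → Fin n → ℝ := fun a b => (if a = b then 0 else c) - ‖ρ (swap a b) x - x‖ ^ 2
  have hd : ∀ a b, 0 ≤ d a b := by
    intro a b
    by_cases hab : a = b
    · subst hab; simp [d, rep_refl_apply]
    · simpa [d, hab] using hle a b hab
  have hrow : ∀ a : Fin n, ∑ b, (if a = b then 0 else c) = (n - 1) * c := by
    intro a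
    have : ∀ b, (if a = b then 0 else c) = c - if a = b then c else 0 := by
      intro b; split_ifs <;> simp
    simp only [this, sum_sub_distrib, sum_ite_eq, mem_univ, if_true, sum_const, card_univ,
      Fintype.card_fin, nsmul_eq_mul]
    ring
  have hsum : ∑ a, ∑ b, d a b ≤ 0 := by
    have h1 := h.four_mul_le_sum hinv x
    simp only [d, sum_sub_distrib, hrow, sum_const, card_univ, Fintype.card_fin, nsmul_eq_mul]
    have : ((n : ℝ) - 1) * c = 4 := by rw [hc]; field_simp [show (n : ℝ) - 1 ≠ 0 by linarith]
    rw [hx] at h1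
    rw [this]
    linarith
  have h1 : d i j ≤ ∑ b, d i b := single_le_sum (fun b _ => hd i b) (mem_univ j)
  have h2 : ∑ b, d i b ≤ ∑ a, ∑ b, d a b :=
    single_le_sum (f := fun a => ∑ b, d a b) (fun a _ => sum_nonneg fun b _ => hd a b) (mem_univ i)
  have h3 : d i j = 0 := le_antisymm (h1.trans (h2.trans hsum)) (hd i j)
  simp only [d, if_neg hij] at h3
  linarith

theorem two_div_sqrt_sq (hn : 2 ≤ n) : (2 / √((n : ℝ) - 1)) ^ 2 = 4 / ((n : ℝ) - 1) := by
  have hn' : (2 : ℝ) ≤ n := by exact_mod_cast hn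
  rw [div_pow, Real.sq_sqrt (by linarith)]
  norm_num

theorem norm_swap_sub_sq_le_of_iSup_le (hn : 2 ≤ n) {x : V}
    (hx : ⨆ q ∈ transpositions n, ENNReal.ofReal ‖ρ q x - x‖
      ≤ ENNReal.ofReal (2 / √((n : ℝ) - 1))) {i j : Fin n} (hij : i ≠ j) :
    ‖ρ (swap i j) x - x‖ ^ 2 ≤ 4 / ((n : ℝ) - 1) := by
  have h1 := (le_iSup₂ (f := fun q (_ : q ∈ transpositions n) => ENNReal.ofReal ‖ρ q x - x‖)
    (swap i j) ⟨i, j, hij, rfl⟩).trans hx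
  rw [← two_div_sqrt_sq hn]
  exact pow_le_pow_left₀ (norm_nonneg _) ((ENNReal.ofReal_le_ofReal_iff (by positivity)).1 h1) 2

theorem IsUnitary.le_kazhdanConstantRep [CompleteSpace V] (h : IsUnitary ρ)
    (hinv : ρ.invariants = ⊥) (hn : 2 ≤ n) :
    ENNReal.ofReal (2 / √((n : ℝ) - 1)) ≤ kazhdanConstantRep (transpositions n) ρ := by
  refine le_iInf₂ fun x hx => ?_
  by_contra! hlt
  let i : Fin n := ⟨0, by omega⟩
  let j : Fin n := ⟨1, by omega⟩
  have hij : i ≠ j := by simp [i, j]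
  have h1 := h.norm_swap_sub_sq_eq hinv hn hx
    (fun a b hab => norm_swap_sub_sq_le_of_iSup_le hn hlt.le hab) hij
  rw [← two_div_sqrt_sq hn] at h1
  have h2 := (pow_left_inj₀ (norm_nonneg _) (by positivity) two_ne_zero).1 h1
  have h3 := le_iSup₂ (f := fun q (_ : q ∈ transpositions n) => ENNReal.ofReal ‖ρ q x - x‖)
    (swap i j) ⟨i, j, hij, rfl⟩
  rw [h2] at h3
  exact absurd hlt (not_lt.2 h3)

theorem le_kazhdanConstant (hn : 2 ≤ n) :
    ENNReal.ofReal (2 / √((n : ℝ) - 1)) ≤ kazhdanConstant.{u} (transpositions n) :=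
  le_iInf fun _ => le_iInf fun _ => le_iInf fun _ => le_iInf fun _ => le_iInf fun _ =>
    le_iInf fun h => le_iInf fun hinv => h.le_kazhdanConstantRep hinv hn

end LowerBound

/-! ### The bound is attained by the regular simplex -/

section Simplex

theorem kazhdanConstant_le_kazhdanConstantRep {G : Type*} [Group G] {V : Type u}
    [i₁ : NormedAddCommGroup V] [i₂ : InnerProductSpace ℂ V] [i₃ : CompleteSpace V] (Q : Set G)
    {ρ : Representation ℂ G V} (h : IsUnitary ρ) (hinv : ρ.invariants = ⊥) :
    kazhdanConstant.{u} Q ≤ kazhdanConstantRep Q ρ :=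
  iInf_le_of_le V <| iInf_le_of_le i₁ <| iInf_le_of_le i₂ <| iInf_le_of_le i₃ <|
    iInf_le_of_le ρ <| iInf_le_of_le h <| iInf_le_of_le hinv le_rfl

/-- The representation of `S_n` on `n × n` matrices by permutation of the rows. -/
noncomputable def rowRep (n : ℕ) :
    Representation ℂ (Perm (Fin n)) (EuclideanSpace ℂ (ULift.{u} (Fin n × Fin n))) where
  toFun π := (LinearIsometryEquiv.piLpCongrLeft 2 ℂ ℂ
    (Equiv.ulift.trans ((π.prodCongr (Equiv.refl (Fin n))).trans
      Equiv.ulift.symm))).toLinearEquiv.toLinearMap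
  map_one' := by
    ext x i
    rfl
  map_mul' π τ := by
    ext x i
    rfl

theorem rowRep_apply (n : ℕ) (π : Perm (Fin n))
    (x : EuclideanSpace ℂ (ULift.{u} (Fin n × Fin n))) (i j : Fin n) :
    rowRep n π x ⟨(i, j)⟩ = x ⟨(π⁻¹ i, j)⟩ := rfl

theorem rowRep_isUnitary (n : ℕ) : IsUnitary (rowRep.{u} n) := fun _ x =>
  LinearIsometryEquiv.norm_map _ x

/-- The matrices all of whose column sums vanish: a direct sum of `n` copies of `[n-1,1]`. -/
noncomputable def rowSubrep (n : ℕ) : Subrepresentation (rowRep.{u} n) where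
  toSubmodule :=
    { carrier := {x | ∀ j, ∑ i, x ⟨(i, j)⟩ = 0}
      add_mem' := fun {x y} hx hy j => by simp [sum_add_distrib, hx j, hy j]
      zero_mem' := fun j => by simp
      smul_mem' := fun c x hx j => by simp [← mul_sum, hx j] }
  apply_mem_toSubmodule π x hx j := by
    rw [← hx j]
    exact Equiv.sum_comp π⁻¹ (fun i => x ⟨(i, j)⟩)

theorem rowSubrep_isUnitary (n : ℕ) :
    IsUnitary (V := (rowSubrep.{u} n).toSubmodule) (rowSubrep.{u} n).toRepresentation :=
  fun π x => rowRep_isUnitary n π x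

theorem rowSubrep_invariants (n : ℕ) : (rowSubrep.{u} n).toRepresentation.invariants = ⊥ := by
  rw [eq_bot_iff]
  rintro ⟨x, hx⟩ hinv
  rw [Representation.mem_invariants] at hinv
  rw [Submodule.mem_bot]
  refine Subtype.ext (PiLp.ext fun p => ?_)
  obtain ⟨i, j⟩ := p
  have h1 : ∀ k, x ⟨(k, j)⟩ = x ⟨(i, j)⟩ := by
    intro k
    have h2 : rowRep n (swap i k) x = x := congrArg Subtype.val (hinv (swap i k))
    have h3 := congrArg (fun y : EuclideanSpace ℂ (ULift.{u} (Fin n × Fin n)) => y ⟨(i, j)⟩) h2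
    simpa [rowRep_apply] using h3
  have h4 := hx j
  simp only [h1, sum_const, card_univ, Fintype.card_fin, nsmul_eq_mul] at h4
  have hn : (n : ℂ) ≠ 0 := Nat.cast_ne_zero.2 (Fin.pos i).ne'
  exact (mul_eq_zero.1 h4).resolve_left hn

theorem norm_sq_eq_sum_sum {n : ℕ} (x : EuclideanSpace ℂ (ULift.{u} (Fin n × Fin n))) :
    ‖x‖ ^ 2 = ∑ i, ∑ j, ‖x ⟨(i, j)⟩‖ ^ 2 := by
  rw [EuclideanSpace.norm_sq_eq, ← Fintype.sum_prod_type' (fun i j => ‖x ⟨(i, j)⟩‖ ^ 2)]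
  exact Equiv.sum_comp Equiv.ulift (fun p : Fin n × Fin n => ‖x ⟨p⟩‖ ^ 2)

/-- The matrix whose rows are the vertices `e_i - (1/n, …, 1/n)` of a regular simplex. -/
noncomputable def simplexMatrix (n : ℕ) : EuclideanSpace ℂ (ULift.{u} (Fin n × Fin n)) :=
  WithLp.toLp 2 fun p => (if p.down.1 = p.down.2 then 1 else 0) - (n : ℂ)⁻¹

theorem simplexMatrix_mem {n : ℕ} (hn : n ≠ 0) :
    simplexMatrix.{u} n ∈ (rowSubrep.{u} n).toSubmodule := by
  intro j
  have : (n : ℂ) ≠ 0 := Nat.cast_ne_zero.2 hn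
  simp [simplexMatrix, this]

theorem norm_simplexMatrix_sq {n : ℕ} (hn : n ≠ 0) : ‖simplexMatrix.{u} n‖ ^ 2 = n - 1 := by
  have hn' : (n : ℝ) ≠ 0 := Nat.cast_ne_zero.2 hn
  have h1 : ∀ i j : Fin n, ‖(simplexMatrix.{u} n) ⟨(i, j)⟩‖ ^ 2
      = (if i = j then 1 - 2 * (n : ℝ)⁻¹ else 0) + (n : ℝ)⁻¹ ^ 2 := by
    intro i j
    have : (simplexMatrix.{u} n) ⟨(i, j)⟩ = (((if i = j then 1 else 0) - (n : ℝ)⁻¹ : ℝ) : ℂ) := by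
      simp only [simplexMatrix]
      split_ifs <;> push_cast <;> rfl
    rw [this, Complex.norm_real, Real.norm_eq_abs, sq_abs]
    split_ifs <;> ring
  rw [norm_sq_eq_sum_sum]
  simp only [h1, sum_add_distrib, sum_ite_eq, mem_univ, if_true, sum_const, card_univ,
    Fintype.card_fin, nsmul_eq_mul]
  field_simp
  ring

/-- The difference has entries `±1` at the four positions in `{a, b} × {a, b}` and zeros elsewhere.
-/
theorem norm_swap_simplexMatrix_sub_sq {n : ℕ} {a b : Fin n} (hab : a ≠ b) :
    ‖rowRep n (swap a b) (simplexMatrix.{u} n) - simplexMatrix.{u} n‖ ^ 2 = 4 := by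
  have h1 : ∀ i j : Fin n,
      ‖(rowRep n (swap a b) (simplexMatrix.{u} n) - simplexMatrix.{u} n) ⟨(i, j)⟩‖ ^ 2
      = ((if i = a then 1 else 0) + if i = b then 1 else 0 : ℝ)
        * ((if a = j then 1 else 0) + if b = j then 1 else 0) := by
    intro i j
    rw [PiLp.sub_apply, rowRep_apply]
    simp only [simplexMatrix, swap_inv, sub_sub_sub_cancel_right]
    rw [swap_apply_def]
    split_ifs <;> simp_all <;> split_ifs <;> simp
  rw [norm_sq_eq_sum_sum]
  simp only [h1, ← mul_sum, sum_add_distrib, sum_ite_eq, sum_ite_eq', mem_univ, if_true, ← sum_mul]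
  norm_num

theorem kazhdanConstant_le {n : ℕ} (hn : 2 ≤ n) :
    kazhdanConstant.{u} (transpositions n) ≤ ENNReal.ofReal (2 / √((n : ℝ) - 1)) := by
  have hn' : (2 : ℝ) ≤ n := by exact_mod_cast hn
  have hs : 0 < √((n : ℝ) - 1) := Real.sqrt_pos.2 (by linarith)
  refine (kazhdanConstant_le_kazhdanConstantRep _ (rowSubrep_isUnitary.{u} n)
    (rowSubrep_invariants n)).trans ?_
  let y : (rowSubrep.{u} n).toSubmodule := ⟨simplexMatrix n, simplexMatrix_mem (by omega)⟩
  have hy : ‖y‖ = √((n : ℝ) - 1) := by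
    rw [← norm_simplexMatrix_sq.{u} (n := n) (by omega), Real.sqrt_sq (norm_nonneg _)]
    rfl
  let c : ℂ := ((√((n : ℝ) - 1))⁻¹ : ℝ)
  have hc : ‖c‖ = (√((n : ℝ) - 1))⁻¹ := by
    rw [Complex.norm_real, Real.norm_of_nonneg (by positivity)]
  refine iInf₂_le_of_le (c • y) (by rw [norm_smul, hc, hy, inv_mul_cancel₀ hs.ne']) ?_
  refine iSup₂_le fun q hq => ENNReal.ofReal_le_ofReal ?_
  obtain ⟨a, b, hab, rfl⟩ := hq
  have h1 : ‖(rowSubrep.{u} n).toRepresentation (swap a b) y - y‖ = 2 := by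
    have h2 : ‖(rowSubrep.{u} n).toRepresentation (swap a b) y - y‖ ^ 2 = 2 ^ 2 :=
      (norm_swap_simplexMatrix_sub_sq.{u} hab).trans (by norm_num)
    exact (pow_left_inj₀ (norm_nonneg _) two_pos.le two_ne_zero).1 h2
  rw [map_smul, ← smul_sub, norm_smul, h1, hc, div_eq_inv_mul]

theorem kazhdanConstant_transpositions {n : ℕ} (hn : 2 ≤ n) :
    kazhdanConstant.{u} (transpositions n) = ENNReal.ofReal (2 / √((n : ℝ) - 1)) :=
  le_antisymm (kazhdanConstant_le hn) (le_kazhdanConstant hn)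

end Simplex

/-! ### Strict inequality for `[n-1,1]` -/

section Standard

/-- There are no four equidistant points in the plane. -/
theorem eq_zero_of_equidistant {s : ℝ} {z : Fin 4 → ℂ}
    (h : ∀ i j, i ≠ j → ‖z i - z j‖ ^ 2 = s) : s = 0 := by
  have key : ∀ i j : Fin 4, i ≠ j →
      ((z i).re - (z j).re) ^ 2 + ((z i).im - (z j).im) ^ 2 = s := by
    intro i j hij
    rw [← h i j hij, ← Complex.normSq_eq_norm_sq, Complex.normSq_apply, Complex.sub_re,
      Complex.sub_im]
    ring
  have h10 := key 1 0 (by decide)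
  have h20 := key 2 0 (by decide)
  have h30 := key 3 0 (by decide)
  have h12 := key 1 2 (by decide)
  have h13 := key 1 3 (by decide)
  have h23 := key 2 3 (by decide)
  generalize (z 0).re = x0, (z 0).im = y0, (z 1).re = x1, (z 1).im = y1, (z 2).re = x2,
    (z 2).im = y2, (z 3).re = x3, (z 3).im = y3 at *
  have g12 : (x1 - x0) * (x2 - x0) + (y1 - y0) * (y2 - y0) = s / 2 := by linarith
  have g13 : (x1 - x0) * (x3 - x0) + (y1 - y0) * (y3 - y0) = s / 2 := by linarith
  have g23 : (x2 - x0) * (x3 - x0) + (y2 - y0) * (y3 - y0) = s / 2 := by linarith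
  -- the Gram determinant of three plane vectors vanishes
  have gram : ∀ a b c d e f : ℝ,
      (a ^ 2 + b ^ 2) * (c ^ 2 + d ^ 2) * (e ^ 2 + f ^ 2)
        + 2 * (a * c + b * d) * (a * e + b * f) * (c * e + d * f)
        - (a ^ 2 + b ^ 2) * (c * e + d * f) ^ 2 - (c ^ 2 + d ^ 2) * (a * e + b * f) ^ 2
        - (e ^ 2 + f ^ 2) * (a * c + b * d) ^ 2 = 0 := by
    intros; ring
  have h0 := gram (x1 - x0) (y1 - y0) (x2 - x0) (y2 - y0) (x3 - x0) (y3 - y0)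
  -- With diagonal entries `s` and off-diagonal entries `s / 2` the Gram determinant is `s ^ 3 / 2`.
  rw [h10, h20, h30, g12, g13, g23] at h0
  have : s ^ 3 = 0 := by linarith
  exact pow_eq_zero_iff (by norm_num) |>.1 this

variable {n : ℕ}

theorem mem_standardSubrep_iff {x : EuclideanSpace ℂ (Fin n)} :
    x ∈ (standardSubrep n).toSubmodule ↔ ∑ k, x k = 0 := by
  change x ∈ (ℂ ∙ (∑ k, EuclideanSpace.single k 1 : EuclideanSpace ℂ (Fin n)))ᗮ ↔ _
  rw [Submodule.mem_orthogonal_singleton_iff_inner_right]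
  simp only [sum_inner, EuclideanSpace.inner_single_left, map_one, one_mul]

/-- The vector `e_i - e_j` of `[n-1,1]`. -/
noncomputable def edgeVector (i j : Fin n) : (standardSubrep n).toSubmodule :=
  ⟨EuclideanSpace.single i 1 - EuclideanSpace.single j 1, by
    rw [mem_standardSubrep_iff]
    simp [sum_sub_distrib]⟩

theorem standardRep_edgeVector (g : Perm (Fin n)) (i j : Fin n) :
    standardRep n g (edgeVector i j) = edgeVector (g i) (g j) := by
  refine Subtype.ext ?_
  change permRep n g (EuclideanSpace.single i 1 - EuclideanSpace.single j 1) = _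
  rw [map_sub, permRep_single, permRep_single]
  rfl

theorem standardRep_swap_sub (i j : Fin n) (x : (standardSubrep n).toSubmodule) :
    standardRep n (swap i j) x - x = (x.1 j - x.1 i) • edgeVector i j := by
  refine Subtype.ext (PiLp.ext fun k => ?_)
  change permRep n (swap i j) x.1 k - x.1 k
    = (x.1 j - x.1 i) * (EuclideanSpace.single i 1 - EuclideanSpace.single j 1 :
        EuclideanSpace ℂ (Fin n)) k
  rw [permRep_apply, swap_inv, swap_apply_def, PiLp.sub_apply, PiLp.single_apply,
    PiLp.single_apply]
  by_cases h1 : k = i <;> by_cases h2 : k = j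
  · simp [← h1, ← h2]
  · subst h1; simp [h2]
  · simp [← h2, h1]
  · simp [h1, h2]

theorem standardRep_invariants (n : ℕ) : (standardRep n).invariants = ⊥ := by
  rw [eq_bot_iff]
  rintro ⟨x, hx⟩ hinv
  rw [Representation.mem_invariants] at hinv
  rw [Submodule.mem_bot]
  refine Subtype.ext (PiLp.ext fun i => ?_)
  have h1 : ∀ k, x k = x i := by
    intro k
    have h2 : permRep n (swap i k) x = x := congrArg Subtype.val (hinv (swap i k))
    have h3 := congrArg (fun y : EuclideanSpace ℂ (Fin n) => y i) h2
    simpa [permRep_apply] using h3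
  have h4 := mem_standardSubrep_iff.1 hx
  simp only [h1, sum_const, card_univ, Fintype.card_fin, nsmul_eq_mul] at h4
  exact (mul_eq_zero.1 h4).resolve_left (Nat.cast_ne_zero.2 (Fin.pos i).ne')

theorem exists_perm_apply_eq_apply_eq {α : Type*} [DecidableEq α] {i j k l : α} (hij : i ≠ j)
    (hkl : k ≠ l) : ∃ g : Perm α, g i = k ∧ g j = l := by
  have h : k ≠ swap i k j := fun h => hij <| (swap i k).injective (by rw [swap_apply_left, ← h])
  exact ⟨swap (swap i k j) l * swap i k, by
    rw [Perm.mul_apply, swap_apply_left, swap_apply_of_ne_of_ne h hkl], by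
    rw [Perm.mul_apply, swap_apply_left]⟩

variable {W : Type*} [NormedAddCommGroup W] [InnerProductSpace ℂ W]
  {D : Representation ℂ (Perm (Fin n)) W}

theorem invariants_eq_bot_of_equiv (φ : D.Equiv (standardRep n)) : D.invariants = ⊥ := by
  rw [eq_bot_iff]
  intro x hx
  rw [Representation.mem_invariants] at hx
  have : φ x ∈ (standardRep n).invariants := fun g => by
    have : φ (D g x) = standardRep n g (φ x) :=
      LinearMap.congr_fun (φ.toIntertwiningMap.isIntertwining' g) x
    rw [hx g] at this
    exact this.symm
  rw [standardRep_invariants, Submodule.mem_bot] at this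
  exact (map_eq_zero_iff φ φ.toLinearEquiv.injective).1 this

/-- In a unitary model of `[n-1,1]` the displacement of a vector under a transposition is
proportional to the difference of two coordinates. -/
theorem IsUnitary.exists_norm_swap_sub_eq (h : IsUnitary D) (φ : D.Equiv (standardRep n)) (x : W) :
    ∃ c : ℝ, ∀ i j, i ≠ j → ‖D (swap i j) x - x‖ = c * ‖(φ x).1 i - (φ x).1 j‖ := by
  by_cases hn : ∃ k l : Fin n, k ≠ l
  swap
  · exact ⟨0, fun i j hij => absurd ⟨i, j, hij⟩ hn⟩
  obtain ⟨k, l, hkl⟩ := hn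
  -- `φ` need not be isometric, but double transitivity and unitarity of `D` give all pulled-back
  -- edge vectors the same norm.
  refine ⟨‖φ.symm (edgeVector k l)‖, fun i j hij => ?_⟩
  have h1 : D (swap i j) x - x = ((φ x).1 j - (φ x).1 i) • φ.symm (edgeVector i j) := by
    apply φ.toLinearEquiv.injective
    change φ (D (swap i j) x - x) = φ (((φ x).1 j - (φ x).1 i) • φ.symm (edgeVector i j))
    rw [map_sub, map_smul, φ.apply_symm_apply, ← standardRep_swap_sub]
    exact congrArg (· - φ x) 
      (LinearMap.congr_fun (φ.toIntertwiningMap.isIntertwining' (swap i j)) x)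
  obtain ⟨g, rfl, rfl⟩ := exists_perm_apply_eq_apply_eq hij hkl
  have h2 : φ.symm (edgeVector (g i) (g j)) = D g (φ.symm (edgeVector i j)) := by
    rw [← standardRep_edgeVector]
    exact LinearMap.congr_fun (φ.symm.toIntertwiningMap.isIntertwining' g) _
  rw [h1, h2, h, norm_smul, norm_sub_rev, mul_comm]

theorem IsUnitary.lt_iSup_of_equiv (h : IsUnitary D) (φ : D.Equiv (standardRep n)) (hn : 4 ≤ n)
    [CompleteSpace W] {x : W} (hx : ‖x‖ = 1) :
    ENNReal.ofReal (2 / √((n : ℝ) - 1))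
      < ⨆ q ∈ transpositions n, ENNReal.ofReal ‖D q x - x‖ := by
  by_contra! hle
  have hn' : (4 : ℝ) ≤ n := by exact_mod_cast hn
  have h1 : ∀ i j, i ≠ j → ‖D (swap i j) x - x‖ ^ 2 = 4 / ((n : ℝ) - 1) := fun i j hij =>
    h.norm_swap_sub_sq_eq (invariants_eq_bot_of_equiv φ) (by omega) hx
      (fun a b hab => norm_swap_sub_sq_le_of_iSup_le (by omega) hle hab) hij
  obtain ⟨c, hc⟩ := h.exists_norm_swap_sub_eq φ x
  have h2 : 4 / ((n : ℝ) - 1) = 0 := by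
    -- The first four coordinates, rescaled by `c`, are equidistant points of the plane; this is
    -- where `4 ≤ n` enters.
    refine eq_zero_of_equidistant (z := fun i => (c : ℂ) * (φ x).1 (Fin.castLE hn i)) ?_
    intro i j hij
    have hij' : Fin.castLE hn i ≠ Fin.castLE hn j := fun h => hij (Fin.castLE_injective hn h)
    rw [← h1 _ _ hij', hc _ _ hij', ← mul_sub, norm_mul, Complex.norm_real, mul_pow, mul_pow,
      Real.norm_eq_abs, sq_abs]
  have : 0 < 4 / ((n : ℝ) - 1) := div_pos (by norm_num) (by linarith)
  exact this.ne' h2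

/-- `W` is finite-dimensional, so the lower semicontinuous maximal displacement attains its infimum
on the compact unit sphere, and the pointwise strict bound passes to the infimum. -/
theorem IsUnitary.lt_kazhdanConstantRep_of_equiv (h : IsUnitary D) (φ : D.Equiv (standardRep n))
    (hn : 4 ≤ n) :
    ENNReal.ofReal (2 / √((n : ℝ) - 1)) < kazhdanConstantRep (transpositions n) D := by
  have : FiniteDimensional ℂ W := Module.Finite.equiv φ.toLinearEquiv.symm
  have : CompleteSpace W := FiniteDimensional.complete ℂ W
  have : ProperSpace W := FiniteDimensional.proper ℂ W
  rcases (Metric.sphere (0 : W) 1).eq_empty_or_nonempty with he | hne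
  · have : kazhdanConstantRep (transpositions n) D = ⊤ :=
      iInf₂_eq_top.2 fun x hx => absurd (mem_sphere_zero_iff_norm.2 hx) (by simp [he])
    rw [this]
    exact ENNReal.ofReal_lt_top
  · have hlsc : LowerSemicontinuousOn
        (fun x => ⨆ q ∈ transpositions n, ENNReal.ofReal ‖D q x - x‖) (Metric.sphere (0 : W) 1) :=
      lowerSemicontinuousOn_biSup fun q _ => Continuous.lowerSemicontinuous
        (ENNReal.continuous_ofReal.comp ((h.continuous q).sub continuous_id).norm)
        |>.lowerSemicontinuousOn _
    obtain ⟨x, hx, hmin⟩ := hlsc.exists_isMinOn hne (isCompact_sphere 0 1)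
    exact (h.lt_iSup_of_equiv φ hn (mem_sphere_zero_iff_norm.1 hx)).trans_le <|
      le_iInf₂ fun y hy => hmin (mem_sphere_zero_iff_norm.2 hy)

end Standard

end Kazhdan

theorem proposition5 (n : ℕ) (hn : 4 ≤ n)
    {W : Type v} [NormedAddCommGroup W] [InnerProductSpace ℂ W]
    (D' : Representation ℂ (Equiv.Perm (Fin n)) W) (hunitary : Kazhdan.IsUnitary D')
    (hequiv : Nonempty (D'.Equiv (Kazhdan.standardRep n))) :
    Kazhdan.kazhdanConstant.{u} (Kazhdan.transpositions n)
        = ENNReal.ofReal (2 / Real.sqrt ((n : ℝ) - 1)) ∧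
      Kazhdan.kazhdanConstant.{u} (Kazhdan.transpositions n)
        < Kazhdan.kazhdanConstantRep (Kazhdan.transpositions n) D' ∧
      ¬ ∀ Q : Set (Equiv.Perm (Fin n)), Q ⊆ Kazhdan.transpositions n → Subgroup.closure Q = ⊤ →
        Kazhdan.kazhdanConstant.{u} Q = Kazhdan.kazhdanConstantRep Q D' := by
  obtain ⟨φ⟩ := hequiv
  have heq := Kazhdan.kazhdanConstant_transpositions.{u} (n := n) (by omega)
  have hlt := heq.trans_lt (hunitary.lt_kazhdanConstantRep_of_equiv φ hn)
  -- The set of all transpositions is itself the counterexample.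
  exact ⟨heq, hlt, fun h => hlt.ne (h _ subset_rfl Equiv.Perm.closure_isSwap)⟩
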